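/- All digraphs are finite, non-empty, without loops and without digons (directed $2$-cycles). Let $D$ be a digraph with vertex set $V$. Write $x\to y$ if $(x,y)$ is an arc, let $N^+(v)$ be the out-neighborhood of $v$ and $N^{++}(v)$ the set of vertices at distance exactly $2$ from $v$. A vertex $v$ has the second neighborhood property (SNP) if $|N^+(v)|\le |N^{++}(v)|$; a sink is a vertex with $N^+(v)=\emptyset$. A missing edge of $D$ is a pair $xy$ of distinct vertices with neither $(x,y)$ nor $(y,x)$ an arc; $D$ is missing a matching if no two distinct missing edges share a vertex (possibly there is no missing edge). A missing edge $x_1y_1$ loses to a missing edge $x_2y_2$ if, for some naming of their endpoints, $x_1\to x_2$, $y_2\notin N^+(x_1)\cup N^{++}(x_1)$, $y_1\to y_2$ and $x_2\notin N^+(y_1)\cup N^{++}(y_1)$. The dependency digraph $\Delta$ has the missing edges as vertices and an arc from $e$ to $f$ whenever $e$ loses to $f$. An ordered pair $(a,b)$, where $ab$ is a missing edge, is a convenient orientation of $ab$ if every $v\in V\setminus\{a,b\}$ with $v\to a$ satisfies $b\in N^+(v)\cup N^{++}(v)$. For every connected component of $\Delta$ that is a directed path $a_1b_1,\dots,a_kb_k$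 ($k\ge 1$; a single isolated vertex of $\Delta$ counts as such a path), with endpoints named so that $a_i\to a_{i+1}$ and $b_i\to b_{i+1}$ for $1\le i<k$, take the arcs $(a_i,b_i)$, $1\le i\le k$, if $(a_1,b_1)$ is a convenient orientation, and the arcs $(b_i,a_i)$, $1\le i\le k$, otherwise. Let $F$ be the set of all these new arcs. Theorem. Let $D$ be a digraph missing a matching and suppose that $F=\emptyset$. If $D$ has no sink, then $D$ has at least two vertices with the SNP. -/

import Mathlib

namespace SecondNeighborhood

variable {V : Type*}

/-- `D` has no loops and no digons (directed cycles of length 2). -/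
def IsOriented (D : Digraph V) : Prop :=
  ∀ u v, D.Adj u v → ¬ D.Adj v u

/-- The out-neighborhood `N⁺(v)`. -/
def outNbhd (D : Digraph V) (v : V) : Set V :=
  {w | D.Adj v w}

/-- The second out-neighborhood `N⁺⁺(v)`: the vertices at distance exactly 2 from `v`. -/
def secondOutNbhd (D : Digraph V) (v : V) : Set V :=
  {w | w ≠ v ∧ ¬ D.Adj v w ∧ ∃ u, D.Adj v u ∧ D.Adj u w}

/-- The second neighborhood property `d⁺(v) ≤ d⁺⁺(v)`. -/
def HasSNP (D : Digraph V) (v : V) : Prop :=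
  (outNbhd D v).ncard ≤ (secondOutNbhd D v).ncard

/-- A sink is a vertex of zero out-degree. -/
def IsSink (D : Digraph V) (v : V) : Prop :=
  outNbhd D v = ∅

/-- The missing graph, on all of `V`; the whole vertices of `D` are its isolated vertices. -/
def missingGraph (D : Digraph V) : SimpleGraph V where
  Adj u v := u ≠ v ∧ ¬ D.Adj u v ∧ ¬ D.Adj v u
  symm := ⟨fun _ _ h => ⟨h.1.symm, h.2.2, h.2.1⟩⟩
  loopless := ⟨fun _ h => h.1 rfl⟩

/-- The type of missing edges of `D`. -/
abbrev MissingEdge (D : Digraph V) : Type _ :=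
  (missingGraph D).edgeSet

/-- `D` is missing a (possibly empty) matching: no two distinct missing edges share a vertex. -/
def IsMissingMatching (D : Digraph V) : Prop :=
  ∀ e f : MissingEdge D, ∀ v : V, v ∈ e.1 → v ∈ f.1 → e = f

/-- The losing relation, for missing edges `x₁y₁` and `x₂y₂` with named endpoints. -/
def Loses (D : Digraph V) (x₁ y₁ x₂ y₂ : V) : Prop :=
  D.Adj x₁ x₂ ∧ y₂ ∉ outNbhd D x₁ ∪ secondOutNbhd D x₁ ∧
    D.Adj y₁ y₂ ∧ x₂ ∉ outNbhd D y₁ ∪ secondOutNbhd D y₁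

/-- The dependency digraph `Δ`: its vertices are the missing edges, its arcs the pairs `(e, f)`
such that `e` loses to `f` for some naming of the endpoints. -/
def dependencyDigraph (D : Digraph V) : Digraph (MissingEdge D) where
  Adj e f := ∃ x₁ y₁ x₂ y₂, e.1 = s(x₁, y₁) ∧ f.1 = s(x₂, y₂) ∧ Loses D x₁ y₁ x₂ y₂

/-- The (weakly) connected components of `Δ`. -/
abbrev DependencyComponent (D : Digraph V) : Type _ :=
  (dependencyDigraph D).toSimpleGraphInclusive.ConnectedComponent

/-- `(a, b)` is a convenient orientation of the missing edge `ab`. -/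
def IsConvenient (D : Digraph V) (a b : V) : Prop :=
  ∀ v, v ≠ a → v ≠ b → D.Adj v a → b ∈ outNbhd D v ∪ secondOutNbhd D v

/-- The component `C` of `Δ` is the directed path `a₀b₀, a₁b₁, …, aₙbₙ` (a single vertex if
`n = 0`), where the endpoints are named such that `aᵢ → aᵢ₊₁` and `bᵢ → bᵢ₊₁` in `D`. -/
structure IsPathLabelling (D : Digraph V) (C : DependencyComponent D) (n : ℕ)
    (a b : Fin (n + 1) → V) : Prop where
  missing : ∀ i, s(a i, b i) ∈ (missingGraph D).edgeSet
  injective : Function.Injective fun i => s(a i, b i)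
  mem_supp_iff : ∀ e : MissingEdge D, e ∈ C.supp ↔ ∃ i, e.1 = s(a i, b i)
  adj_iff : ∀ i j, (dependencyDigraph D).Adj ⟨s(a i, b i), missing i⟩ ⟨s(a j, b j), missing j⟩ ↔
    (i : ℕ) + 1 = j
  label : ∀ i j : Fin (n + 1), (i : ℕ) + 1 = j → D.Adj (a i) (a j) ∧ D.Adj (b i) (b j)

/-- The component `C` of `Δ` is a directed path. -/
def IsPathComponent (D : Digraph V) (C : DependencyComponent D) : Prop :=
  ∃ (n : ℕ) (a b : Fin (n + 1) → V), IsPathLabelling D C n a b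

/-- `A` is a set of arcs chosen for the path component `C = a₀b₀, …, aₙbₙ`: all the `(aᵢ, bᵢ)` if
`(a₀, b₀)` is a convenient orientation, and all the `(bᵢ, aᵢ)` otherwise. -/
def IsPathOrientation (D : Digraph V) (C : DependencyComponent D) (A : Set (V × V)) : Prop :=
  ∃ (n : ℕ) (a b : Fin (n + 1) → V), IsPathLabelling D C n a b ∧
    ((IsConvenient D (a 0) (b 0) ∧ A = Set.range fun i => (a i, b i)) ∨
      (¬ IsConvenient D (a 0) (b 0) ∧ A = Set.range fun i => (b i, a i)))

/-- `F` is a set of new arcs obtained by orienting, as above, the missing edges in all the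
components of `Δ` that are directed paths. (The set depends on the naming of the endpoints.) -/
def IsAddedArcSet (D : Digraph V) (F : Set (V × V)) : Prop :=
  ∃ A : DependencyComponent D → Set (V × V),
    (∀ C, IsPathComponent D C → IsPathOrientation D C (A C)) ∧
      F = ⋃ (C : DependencyComponent D) (_ : IsPathComponent D C), A C

end SecondNeighborhood

/-! In Δ a missing edge loses to at most one edge and at most one edge loses to it
(`Loses.right_unique`, `Loses.left_unique`), so components are directed paths or directed cycles; an
empty `F` leaves only cycles. Let `m` swap the endpoints of each missing edge, and let `τ x` be the
endpoint of the next edge that `x` does not reach within two steps. Since `τ x` inherits every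
out-neighbor of `x` except `m (τ x)`, each cycle of the permutation `τ` is a module of D
(`IsLosingPerm.adj_of_sameCycle`); with `x` it contains `m x`. Inside its module a vertex has at
least as many second out-neighbors as out-neighbors (`IsLosingPerm.ncard_inter_le`).

Replacing each module by a transitive tournament gives a tournament `T`. Outside its module a vertex
keeps its out-neighbors, and its second out-neighbors in `T` are also ones in D, so the SNP passes
from `T` to D. If `T` has no sink, the Havet–Thomassé theorem (`exists_two_hasSNP_of_tournament`, by
median orders and sedimentation) gives two vertices. If `T` has a sink, no arc of D leaves its
module, so all vertices of the module have the SNP; the sink of `T` has an out-neighbor in D, which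
is a second such vertex. -/

open Finset

namespace SecondNeighborhood

/-! ### Median orders, the feedback property and sedimentation. -/

section Median

open scoped Classical

variable {V : Type*}

/-- The arcs of `r` inside `S` that point forward in the order given by the positions `p`. -/
noncomputable def forwardArcs (r : V → V → Prop) (S : Finset V) (p : V → ℤ) : Finset (V × V) :=
  (S ×ˢ S).filter fun e => r e.1 e.2 ∧ p e.1 < p e.2

/-- The order given by the positions `p` is a median order of the tournament induced by `r`
on `S`. -/
def IsMedianOrder (r : V → V → Prop) (S : Finset V) (p : V → ℤ) : Prop :=
  Function.Injective p ∧
    ∀ q : V → ℤ, Function.Injective q → #(forwardArcs r S q) ≤ #(forwardArcs r S p)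

/-- The in-neighbors of `f` that are dominated by an earlier out-neighbor of `f`. -/
noncomputable def goodVertices (r : V → V → Prop) (S : Finset V) (p : V → ℤ) (f : V) : Finset V :=
  S.filter fun v => r v f ∧ ∃ u ∈ S, r f u ∧ r u v ∧ p u < p v

/-- The in-neighbors of `f` that are not good. -/
def IsBad (r : V → V → Prop) (S : Finset V) (p : V → ℤ) (f v : V) : Prop :=
  v ∈ S ∧ r v f ∧ ∀ u ∈ S, r f u → r u v → p v ≤ p u

variable {r : V → V → Prop} {S : Finset V} {p : V → ℤ}

/-- Otherwise moving `c` back to just after position `t` would gain forward arcs. -/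
theorem IsMedianOrder.feedback (hp : IsMedianOrder r S p) (t : ℤ) {c : V} (hc : c ∈ S) :
    #{v ∈ S | r c v ∧ t < p v ∧ p v < p c} ≤ #{v ∈ S | r v c ∧ t < p v ∧ p v < p c} := by
  by_cases htc : p c ≤ t
  · have : ({v ∈ S | r c v ∧ t < p v ∧ p v < p c} : Finset V) = ∅ := by
      ext v; simp only [mem_filter, notMem_empty, iff_false]; rintro ⟨-, -, h1, h2⟩; omega
    simp [this]
  -- Doubling the positions frees the odd slot just after `t` for `c`.
  let q : V → ℤ := fun v => if v = c then 2 * t + 1 else 2 * p v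
  have hq : Function.Injective q := by
    intro a b h
    simp only [q] at h
    split_ifs at h with h1 h2 h2
    · rw [h1, h2]
    · omega
    · omega
    · exact hp.1 (by omega)
  have h1 := hp.2 q hq
  rw [← card_sdiff_le_card_sdiff_iff] at h1
  have hqc : q c = 2 * t + 1 := by simp [q]
  have hqv : ∀ v, v ≠ c → q v = 2 * p v := fun v hv => by simp [q, hv]
  calc #{v ∈ S | r c v ∧ t < p v ∧ p v < p c}
      ≤ #(forwardArcs r S q \ forwardArcs r S p) := by
        refine card_le_card_of_injOn (fun v => (c, v)) ?_ (fun a _ b _ h => (Prod.ext_iff.1 h).2)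
        intro v hv
        simp only [coe_filter, Set.mem_ofPred_eq] at hv
        have hvc : v ≠ c := by rintro rfl; omega
        simp only [forwardArcs, coe_sdiff, Set.mem_sdiff, mem_coe, mem_filter, mem_product, hqc,
          hqv v hvc]
        refine ⟨⟨⟨hc, hv.1⟩, hv.2.1, by omega⟩, fun h => by omega⟩
    _ ≤ _ := h1
    _ ≤ #{v ∈ S | r v c ∧ t < p v ∧ p v < p c} := by
        refine card_le_card_of_injOn (fun e => e.1) ?_ ?_
        · rintro ⟨u, v⟩ h
          simp only [forwardArcs, coe_sdiff, Set.mem_sdiff, mem_coe, mem_filter, mem_product] at h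
          obtain ⟨⟨⟨hu, hv⟩, huv, hlt⟩, h2⟩ := h
          have h2 : q v ≤ q u := by
            by_contra h3
            exact h2 ⟨⟨hu, hv⟩, huv, by omega⟩
          by_cases hvc : v = c
          · subst hvc
            have huc : u ≠ v := by rintro rfl; omega
            rw [hqc, hqv u huc] at h2
            simp only [coe_filter, Set.mem_ofPred_eq]
            exact ⟨hu, huv, by omega, hlt⟩
          · rw [hqv v hvc] at h2
            by_cases huc : u = c
            · subst huc; rw [hqc] at h2; omega
            · rw [hqv u huc] at h2; omega
        · rintro ⟨u, v⟩ h ⟨u', v'⟩ h' (rfl : u = u')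
          have key : ∀ w, (u, w) ∈ (forwardArcs r S p \ forwardArcs r S q) → w = c := by
            intro w h
            simp only [forwardArcs, mem_sdiff, mem_filter, mem_product] at h
            obtain ⟨⟨⟨hu, hv⟩, huv, hlt⟩, h2⟩ := h
            have h2 : q w ≤ q u := by
              by_contra h3
              exact h2 ⟨⟨hu, hv⟩, huv, by omega⟩
            by_contra hvc
            rw [hqv w hvc] at h2
            by_cases huc : u = c
            · subst huc; rw [hqc] at h2; omega
            · rw [hqv u huc] at h2; omega
          rw [key v h, key v' h']

/-- Cut the window at a bad vertex and induct on its length. In a window without bad vertices,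
out-neighbors of `f` are out-neighbors of `c`, and in-neighbors of `c` are good, so the feedback
property at `c` suffices. -/
theorem IsMedianOrder.card_out_le_card_good (hr : ∀ u v, r u v → ¬ r v u)
    (ht : ∀ u v, u ≠ v → r u v ∨ r v u) (hp : IsMedianOrder r S p) {f : V} (hf : f ∈ S)
    (hmax : ∀ v ∈ S, p v ≤ p f) (t : ℤ) {c : V} (hc : c = f ∨ IsBad r S p f c) :
    #{v ∈ S | r f v ∧ t < p v ∧ p v < p c} ≤
      #{v ∈ goodVertices r S p f | t < p v ∧ p v < p c} := by
  obtain ⟨n, hn⟩ : ∃ n, n = (p c - t).toNat := ⟨_, rfl⟩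
  induction n using Nat.strong_induction_on generalizing t c with
  | _ n ih =>
  subst hn
  by_cases hb : ∃ b, IsBad r S p f b ∧ t < p b ∧ p b < p c
  · obtain ⟨b, hbad, htb, hbc⟩ := hb
    have h1 := ih _ (by omega) t (Or.inr hbad) rfl
    have h2 := ih _ (by omega) (p b) hc rfl
    have e1 : ({v ∈ S | r f v ∧ t < p v ∧ p v < p c} : Finset V) ⊆
        {v ∈ S | r f v ∧ t < p v ∧ p v < p b} ∪ {v ∈ S | r f v ∧ p b < p v ∧ p v < p c} := by
      intro v hv
      simp only [mem_filter, mem_union] at hv ⊢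
      rcases lt_trichotomy (p v) (p b) with h | h | h
      · exact Or.inl ⟨hv.1, hv.2.1, hv.2.2.1, h⟩
      · have := hp.1 h
        subst this
        exact absurd hv.2.1 (hr _ _ hbad.2.1)
      · exact Or.inr ⟨hv.1, hv.2.1, h, hv.2.2.2⟩
    have e2 : ({v ∈ goodVertices r S p f | t < p v ∧ p v < p b} ∪
        {v ∈ goodVertices r S p f | p b < p v ∧ p v < p c} : Finset V) ⊆
        {v ∈ goodVertices r S p f | t < p v ∧ p v < p c} := by
      intro v hv
      simp only [mem_filter, mem_union] at hv ⊢
      rcases hv with ⟨h, h1, h2⟩ | ⟨h, h1, h2⟩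
      · exact ⟨h, h1, by omega⟩
      · exact ⟨h, by omega, h2⟩
    have e3 : Disjoint ({v ∈ goodVertices r S p f | t < p v ∧ p v < p b} : Finset V)
        {v ∈ goodVertices r S p f | p b < p v ∧ p v < p c} := by
      rw [disjoint_left]
      intro v hv hv'
      simp only [mem_filter] at hv hv'
      omega
    calc _ ≤ _ := card_le_card e1
      _ ≤ _ := card_union_le _ _
      _ ≤ _ := add_le_add h1 h2
      _ = _ := (card_union_of_disjoint e3).symm
      _ ≤ _ := card_le_card e2
  · have hcS : c ∈ S := by rcases hc with rfl | h; exacts [hf, h.1]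
    have key : ∀ v ∈ S, r f v → p v < p c → r c v := by
      intro v hv hfv hlt
      rcases hc with rfl | h
      · exact hfv
      · rcases ht c v (by rintro rfl; omega) with h1 | h1
        · exact h1
        · have := h.2.2 v hv hfv h1
          omega
    calc #{v ∈ S | r f v ∧ t < p v ∧ p v < p c}
        ≤ #{v ∈ S | r c v ∧ t < p v ∧ p v < p c} := by
          refine card_le_card fun v hv => ?_
          simp only [mem_filter] at hv ⊢
          exact ⟨hv.1, key v hv.1 hv.2.1 hv.2.2.2, hv.2.2⟩
      _ ≤ _ := hp.feedback t hcS
      _ ≤ _ := by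
          refine card_le_card fun v hv => ?_
          simp only [mem_filter, goodVertices] at hv ⊢
          have hvf : v ≠ f := by
            rintro rfl
            have := hmax c hcS
            omega
          have hrv : r v f := (ht v f hvf).resolve_right fun h =>
            hr _ _ hv.2.1 (key v hv.1 h hv.2.2.2)
          refine ⟨⟨hv.1, hrv, ?_⟩, hv.2.2⟩
          by_contra h
          push Not at h
          exact hb ⟨v, ⟨hv.1, hrv, h⟩, hv.2.2⟩

variable [Finite V]

theorem exists_isMedianOrder (r : V → V → Prop) (S : Finset V) : ∃ p, IsMedianOrder r S p := by
  obtain ⟨f, hf⟩ := exists_injective_nat V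
  let P : ℕ → Prop := fun n => ∃ q : V → ℤ, Function.Injective q ∧ #(forwardArcs r S q) = n
  have h0 : P #(forwardArcs r S fun v => (f v : ℤ)) :=
    ⟨_, fun a b h => hf (by exact_mod_cast h), rfl⟩
  have hb : ∀ q : V → ℤ, #(forwardArcs r S q) ≤ #(S ×ˢ S) := fun q =>
    card_le_card (filter_subset _ _)
  obtain ⟨p, hp, hpn⟩ := Nat.findGreatest_spec (P := P) (hb _) h0
  exact ⟨p, hp, fun q hq => hpn ▸ Nat.le_findGreatest (hb q) ⟨q, hq, rfl⟩⟩

theorem IsMedianOrder.card_out_le (hr : ∀ u v, r u v → ¬ r v u)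
    (ht : ∀ u v, u ≠ v → r u v ∨ r v u) (hp : IsMedianOrder r S p) {f : V} (hf : f ∈ S)
    (hmax : ∀ v ∈ S, p v ≤ p f) :
    #{v ∈ S | r f v} ≤ #(goodVertices r S p f) := by
  obtain ⟨m, hm⟩ := (Set.finite_range p).bddBelow
  have hm : ∀ v, m ≤ p v := fun v => hm ⟨v, rfl⟩
  refine le_trans (card_le_card fun v hv => ?_)
    ((hp.card_out_le_card_good hr ht hf hmax (m - 1) (Or.inl rfl)).trans
      (card_le_card (filter_subset _ _)))
  simp only [mem_filter] at hv ⊢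
  have h1 := hmax v hv.1
  have h2 := hm v
  have h3 : p v ≠ p f := fun h => by
    have := hp.1 h
    subst this
    exact hr _ _ hv.2 hv.2
  exact ⟨hv.1, hv.2, by omega, by omega⟩

/-- Sedimentation: moving the bad vertices to the front, followed by the last vertex `f`. -/
theorem IsMedianOrder.exists_sedimentation (hr : ∀ u v, r u v → ¬ r v u)
    (ht : ∀ u v, u ≠ v → r u v ∨ r v u) (hp : IsMedianOrder r S p) {f : V} (hf : f ∈ S)
    (hmax : ∀ v ∈ S, p v ≤ p f) (heq : #{v ∈ S | r f v} = #(goodVertices r S p f)) :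
    ∃ q, IsMedianOrder r S q ∧ (∀ v, v ≠ f → ¬ IsBad r S p f v → q v = p v) ∧
      (∀ v, p f ≠ p v → ¬ IsBad r S p f v → q f < q v) ∧ ∀ v, IsBad r S p f v → q v < q f := by
  obtain ⟨m, hm⟩ := (Set.finite_range p).bddBelow
  have hm : ∀ v, m ≤ p v := fun v => hm ⟨v, rfl⟩
  obtain ⟨M, hM⟩ := (Set.finite_range p).bddAbove
  have hM : ∀ v, p v ≤ M := fun v => hM ⟨v, rfl⟩
  have hff : ¬ IsBad r S p f f := fun h => hr _ _ h.2.1 h.2.1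
  -- Old positions lie in `[m, M]`, so this shift puts the bad vertices below `m - 1` and keeps
  -- their mutual order.
  let q : V → ℤ := fun v => if v = f then m - 1 else
    if IsBad r S p f v then p v - (M - m + 2) else p v
  have q1 : q f = m - 1 := by simp [q]
  have q2 : ∀ v, IsBad r S p f v → q v = p v - (M - m + 2) := by
    intro v hv
    have : v ≠ f := by rintro rfl; exact hff hv
    simp [q, hv, this]
  have q3 : ∀ v, v ≠ f → ¬ IsBad r S p f v → q v = p v := by
    intro v h1 h2
    simp [q, h1, h2]
  have hq : Function.Injective q := by
    intro a b h
    have ha := hm a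
    have hb := hm b
    have ha' := hM a
    have hb' := hM b
    simp only [q] at h
    split_ifs at h with h1 h2 h2 <;> first | (exfalso; omega) | exact hp.1 (by omega) | simp_all
  refine ⟨q, ⟨hq, fun q' hq' => (hp.2 q' hq').trans ?_⟩, q3, ?_, ?_⟩
  · rw [← card_sdiff_le_card_sdiff_iff]
    -- `X` moves to the front and `Y` stays, so only arcs between them can turn: `e1` covers the
    -- losses, `e2` the gains.
    set X : Finset V := {c ∈ S | c = f ∨ IsBad r S p f c} with hX
    set Y : Finset V := {c ∈ S | c ≠ f ∧ ¬ IsBad r S p f c} with hY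
    have e1 : forwardArcs r S p \ forwardArcs r S q ⊆
        X.biUnion fun c => {v ∈ Y | r v c ∧ p v < p c}.image fun v => (v, c) := by
      rintro ⟨u, v⟩ h
      simp only [forwardArcs, mem_sdiff, mem_filter, mem_product] at h
      obtain ⟨⟨⟨hu, hv⟩, huv, hlt⟩, h2⟩ := h
      have h2 : q v ≤ q u := by
        by_contra h3
        exact h2 ⟨⟨hu, hv⟩, huv, by omega⟩
      have huf : u ≠ f := by
        rintro rfl
        have := hmax v hv
        omega
      have hu' := hm u
      have hv' := hM v
      have hub : ¬ IsBad r S p f u := by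
        intro hb
        rw [q2 u hb] at h2
        by_cases hvf : v = f
        · subst hvf; have := hM u; omega
        · by_cases hvb : IsBad r S p f v
          · rw [q2 v hvb] at h2; omega
          · rw [q3 v hvf hvb] at h2; omega
      rw [q3 u huf hub] at h2
      have hvX : v = f ∨ IsBad r S p f v := by
        by_contra hc
        push Not at hc
        rw [q3 v hc.1 hc.2] at h2
        omega
      simp only [mem_biUnion, mem_image, mem_filter, hX, hY, Prod.mk.injEq]
      exact ⟨v, ⟨hv, hvX⟩, u, ⟨⟨hu, huf, hub⟩, huv, hlt⟩, rfl, rfl⟩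
    have e2 : (X.biUnion fun c => {v ∈ Y | r c v ∧ p v < p c}.image fun v => (c, v)) ⊆
        forwardArcs r S q \ forwardArcs r S p := by
      rintro ⟨c, v⟩ h
      simp only [mem_biUnion, mem_image, mem_filter, hX, hY, Prod.mk.injEq] at h
      obtain ⟨_, ⟨hcS, hc⟩, _, ⟨⟨hv, hvf, hvb⟩, hcv, hlt⟩, rfl, rfl⟩ := h
      simp only [forwardArcs, mem_sdiff, mem_filter, mem_product]
      refine ⟨⟨⟨hcS, hv⟩, hcv, ?_⟩, fun h => by omega⟩
      rw [q3 _ hvf hvb]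
      rename_i c v
      have h1 := hm v
      have h2 := hM c
      rcases hc with rfl | hc
      · omega
      · rw [q2 _ hc]; omega
    have e3 : ∀ c ∈ X, #({v ∈ Y | r v c ∧ p v < p c}) ≤ #({v ∈ Y | r c v ∧ p v < p c}) := by
      intro c hc
      have hc' : c = f ∨ IsBad r S p f c := (mem_filter.1 hc).2
      have hcS : c ∈ S := (mem_filter.1 hc).1
      have key : ∀ v ∈ S, r f v → p v < p c → r c v := by
        intro v hv hfv hlt
        rcases hc' with rfl | h
        · exact hfv
        · rcases ht c v (by rintro rfl; omega) with h1 | h1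
          · exact h1
          · have := h.2.2 v hv hfv h1
            omega
      calc #({v ∈ Y | r v c ∧ p v < p c})
          ≤ #{v ∈ goodVertices r S p f | p v < p c} := by
            refine card_le_card fun v hv => ?_
            simp only [mem_filter, goodVertices, hY] at hv ⊢
            obtain ⟨⟨hv, hvf, hvb⟩, hvc, hlt⟩ := hv
            have hrv : r v f := (ht v f hvf).resolve_right fun h => hr _ _ hvc (key v hv h hlt)
            refine ⟨⟨hv, hrv, ?_⟩, hlt⟩
            by_contra h
            push Not at h
            exact hvb ⟨hv, hrv, h⟩
        _ ≤ #{v ∈ S | r f v ∧ p v < p c} := by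
            -- Beyond `c` the out-neighbors of `f` are at most as many as the good vertices;
            -- equality in total reverses this before `c`.
            have h1 := hp.card_out_le_card_good hr ht hf hmax (p c) (Or.inl rfl)
            have h1' : #{v ∈ S | r f v ∧ ¬ p v < p c} ≤
                #{v ∈ goodVertices r S p f | ¬ p v < p c} := by
              refine le_trans (card_le_card fun v hv => ?_) (h1.trans (card_le_card fun v hv => ?_))
              · simp only [mem_filter] at hv ⊢
                have h2 := hmax v hv.1
                have h3 : p v ≠ p f := fun h => by
                  have := hp.1 h
                  subst this
                  exact hr _ _ hv.2.1 hv.2.1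
                have h4 : p v ≠ p c := fun h => by
                  have := hp.1 h
                  subst this
                  rcases hc' with rfl | hc'
                  · exact h3 rfl
                  · exact hr _ _ hv.2.1 hc'.2.1
                exact ⟨hv.1, hv.2.1, by omega, by omega⟩
              · simp only [mem_filter] at hv ⊢
                exact ⟨hv.1, by omega⟩
            have h2 := card_filter_add_card_filter_not (s := goodVertices r S p f)
              (fun v => p v < p c)
            have h3 := card_filter_add_card_filter_not (s := {v ∈ S | r f v}) (fun v => p v < p c)
            rw [filter_filter, filter_filter] at h3
            omega
        _ ≤ _ := by
            refine card_le_card fun v hv => ?_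
            simp only [mem_filter, hY] at hv ⊢
            refine ⟨⟨hv.1, ?_, fun h => hr _ _ hv.2.1 h.2.1⟩, key v hv.1 hv.2.1 hv.2.2, hv.2.2⟩
            rintro rfl
            exact hr _ _ hv.2.1 hv.2.1
    calc _ ≤ _ := card_le_card e1
      _ ≤ _ := card_biUnion_le
      _ ≤ ∑ c ∈ X, #({v ∈ Y | r c v ∧ p v < p c}.image fun v => (c, v)) := by
        refine sum_le_sum fun c hc => card_image_le.trans ((e3 c hc).trans (le_of_eq ?_))
        exact (card_image_of_injective _ fun a b h => (Prod.ext_iff.1 h).2).symm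
      _ = _ := by
        refine (card_biUnion fun c _ d _ hcd => ?_).symm
        rw [Function.onFun, disjoint_left]
        rintro ⟨a, b⟩ h h'
        simp only [mem_image, Prod.mk.injEq] at h h'
        obtain ⟨_, -, h1, -⟩ := h
        obtain ⟨_, -, h2, -⟩ := h'
        exact hcd (h1.trans h2.symm)
      _ ≤ _ := card_le_card e2
  · intro v hv hvb
    rw [q1, q3 v (fun h => hv (h ▸ rfl)) hvb]
    have := hm v
    omega
  · intro v hv
    rw [q1, q2 v hv]
    have := hM v
    omega

end Median

/-! ### Two vertices with the SNP in a tournament without sink. -/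

section Tournament

open scoped Classical

variable {V : Type*} {r : V → V → Prop} {p : V → ℤ}

/-- A second vertex with the second neighborhood property, different from `g`. -/
theorem IsMedianOrder.exists_card_out_le [Fintype V] (hr : ∀ u v, r u v → ¬ r v u)
    (ht : ∀ u v, u ≠ v → r u v ∨ r v u) {g x : V} (hgx : r g x)
    (hp : IsMedianOrder r (univ.erase g) p) :
    ∃ y, y ≠ g ∧ #{v | r y v} ≤ #{w | w ≠ y ∧ ¬ r y w ∧ ∃ u, r y u ∧ r u w} := by
  -- Induction on the number of vertices after `x`.
  obtain ⟨n, hn⟩ : ∃ n, n = #{v ∈ univ.erase g | p x < p v} := ⟨_, rfl⟩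
  induction n using Nat.strong_induction_on generalizing p with
  | _ n ih =>
  subst hn
  set S : Finset V := univ.erase g with hS
  have hgx' : x ≠ g := by rintro rfl; exact hr _ _ hgx hgx
  have hmem : ∀ v, v ∈ S ↔ v ≠ g := fun v => by simp [hS]
  obtain ⟨y, hyS, hmax⟩ := exists_max_image S p ⟨x, (hmem x).2 hgx'⟩
  have hyg : y ≠ g := (hmem y).1 hyS
  have h1 := hp.card_out_le hr ht hyS hmax
  have hG : goodVertices r S p y ⊆
      ({w | w ≠ y ∧ ¬ r y w ∧ ∃ u, r y u ∧ r u w} : Finset V) := by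
    intro v hv
    simp only [goodVertices, mem_filter, mem_univ, true_and] at hv ⊢
    obtain ⟨-, hvy, u, -, hyu, huv, -⟩ := hv
    exact ⟨by rintro rfl; exact hr _ _ hvy hvy, hr _ _ hvy, u, hyu, huv⟩
  have hGc := card_le_card hG
  rcases ht g y hyg.symm with hgy | hyg'
  · refine ⟨y, hyg, le_trans (card_le_card fun v hv => ?_) (h1.trans hGc)⟩
    simp only [mem_filter, mem_univ, true_and, hmem] at hv ⊢
    exact ⟨by rintro rfl; exact hr _ _ hgy hv, hv⟩
  -- Now `y → g`: `y` has one out-neighbor outside `S`, so one extra second out-neighbor is needed.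
  have hout : #{v | r y v} ≤ #{v ∈ S | r y v} + 1 := by
    refine le_trans (card_le_card fun v hv => ?_) (card_insert_le g _)
    simp only [mem_filter, mem_univ, true_and, hmem, mem_insert] at hv ⊢
    by_cases h : v = g
    · exact Or.inl h
    · exact Or.inr ⟨h, hv⟩
  rcases h1.lt_or_eq with hlt | heq
  · exact ⟨y, hyg, by omega⟩
  have hxy : x ≠ y := by rintro rfl; exact hr _ _ hgx hyg'
  -- A bad `x` is that extra vertex, through `y → g → x`. Otherwise sedimentation fixes `x` and
  -- sends `y` before it, so fewer vertices follow `x`.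
  by_cases hxb : IsBad r S p y x
  · refine ⟨y, hyg, ?_⟩
    have hx : x ∉ goodVertices r S p y := by
      simp only [goodVertices, mem_filter, not_and, not_exists]
      intro _ _ u hu hyu hux
      have := hxb.2.2 u hu hyu hux
      omega
    have hsub : insert x (goodVertices r S p y) ⊆
        ({w | w ≠ y ∧ ¬ r y w ∧ ∃ u, r y u ∧ r u w} : Finset V) := by
      refine insert_subset ?_ hG
      simp only [mem_filter, mem_univ, true_and]
      exact ⟨hxy, hr _ _ hxb.2.1, g, hyg', hgx⟩
    have := card_le_card hsub
    rw [card_insert_of_notMem hx] at this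
    omega
  · obtain ⟨q, hq, q1, q2, q3⟩ := hp.exists_sedimentation hr ht hyS hmax heq
    refine ih _ (card_lt_card ?_) hq rfl
    have hxq := q2 x (fun h => hxy (hp.1 h).symm) hxb
    rw [ssubset_iff_of_subset]
    · refine ⟨y, ?_, ?_⟩
      · simp only [mem_filter]
        have h2 := hmax x ((hmem x).2 hgx')
        have h3 : p x ≠ p y := fun h => hxy (hp.1 h)
        exact ⟨hyS, by omega⟩
      · simp only [mem_filter]
        intro h
        omega
    · intro v hv
      simp only [mem_filter] at hv ⊢
      have hvy : v ≠ y := by rintro rfl; omega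
      have hvb : ¬ IsBad r S p y v := fun h => by
        have := q3 v h
        omega
      rw [q1 v hvy hvb, q1 x hxy hxb] at hv
      exact hv

end Tournament

theorem exists_two_hasSNP_of_tournament {V : Type*} [Finite V] [Nonempty V] {T : Digraph V}
    (hT : IsOriented T) (ht : ∀ u v, u ≠ v → T.Adj u v ∨ T.Adj v u)
    (hsink : ∀ v, ¬ IsSink T v) : ∃ u v, u ≠ v ∧ HasSNP T u ∧ HasSNP T v := by
  classical
  have := Fintype.ofFinite V
  have conv : ∀ y, #{v | T.Adj y v} ≤ #{w | w ≠ y ∧ ¬ T.Adj y w ∧ ∃ u, T.Adj y u ∧ T.Adj u w} →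
      HasSNP T y := by
    intro y hy
    rw [HasSNP, outNbhd, secondOutNbhd, Set.ncard_eq_toFinset_card', Set.ncard_eq_toFinset_card']
    simpa using hy
  obtain ⟨p, hp⟩ := exists_isMedianOrder T.Adj (univ : Finset V)
  obtain ⟨g, -, hmax⟩ := exists_max_image (univ : Finset V) p univ_nonempty
  obtain ⟨x, hx⟩ := Set.nonempty_iff_ne_empty.2 (hsink g)
  obtain ⟨q, hq⟩ := exists_isMedianOrder T.Adj (univ.erase g)
  obtain ⟨y, hyg, hy⟩ := hq.exists_card_out_le hT ht hx
  refine ⟨y, g, hyg, conv y (by convert hy), conv g ?_⟩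
  refine (hp.card_out_le hT ht (mem_univ g) hmax).trans (card_le_card fun v hv => ?_)
  simp only [goodVertices, mem_filter, mem_univ, true_and] at hv ⊢
  obtain ⟨hvy, u, hyu, huv, -⟩ := hv
  exact ⟨by rintro rfl; exact hT _ _ hvy hvy, hT _ _ hvy, u, hyu, huv⟩

end SecondNeighborhood

namespace SecondNeighborhood

/-! ### The losing relation. -/

section Losing

variable {V : Type*} {D : Digraph V}

theorem IsMissingMatching.eq (hM : IsMissingMatching D) {x y z : V}
    (hy : (missingGraph D).Adj x y) (hz : (missingGraph D).Adj x z) : y = z := by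
  exact Sym2.congr_right.1
    (congrArg Subtype.val (hM ⟨s(x, y), hy⟩ ⟨s(x, z), hz⟩ x (by simp) (by simp)))

/-- In the naming `x x' y' y`, the vertex `y` is the endpoint that `x` does not reach within two
steps. -/
theorem Loses.swap {x x' y y' : V} (h : Loses D x x' y' y) : Loses D x' x y y' :=
  ⟨h.2.2.1, h.2.2.2, h.1, h.2.1⟩

theorem adj_or_adj {x y : V} (hxy : x ≠ y) (h : ¬ (missingGraph D).Adj x y) :
    D.Adj x y ∨ D.Adj y x := by
  by_contra hc
  push Not at hc
  exact h ⟨hxy, hc.1, hc.2⟩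

theorem Loses.not_adj {x x' y y' : V} (h : Loses D x x' y' y) : ¬ D.Adj x y :=
  fun hxy => h.2.1 (Or.inl hxy)

theorem Loses.adj_head (hD : IsOriented D) (hM : IsMissingMatching D) {x x' y y' : V}
    (hx : (missingGraph D).Adj x x') (hy : (missingGraph D).Adj y y') (h : Loses D x x' y' y) :
    D.Adj y x := by
  refine (adj_or_adj ?_ ?_).resolve_right h.not_adj
  · rintro rfl
    exact hy.2.1 h.1
  · intro hyx
    have := hM.eq hyx.symm hx
    subst this
    exact hD _ _ h.2.2.1 h.2.2.1

/-- Out-neighbors are inherited along the losing relation. -/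
theorem Loses.adj_of_adj (hM : IsMissingMatching D) {x x' y y' w : V}
    (hy : (missingGraph D).Adj y y') (h : Loses D x x' y' y)
    (hw : D.Adj x w) (hwy : w ≠ y') : D.Adj y w := by
  have hne : y ≠ w := by
    rintro rfl
    exact h.not_adj hw
  -- An arc `w → y` would put `y` at distance two from `x`.
  refine (adj_or_adj hne fun hyw => hwy (hM.eq hyw hy)).resolve_right fun hwy => h.2.1 (Or.inr ?_)
  refine ⟨?_, h.not_adj, w, hw, hwy⟩
  rintro rfl
  exact hy.2.1 h.1

/-- If `y ≠ z`, inheriting `x → z'` along the first loss and `x' → y` along the second produces the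
digon `y → z'`, `z' → y`. -/
theorem Loses.right_unique (hD : IsOriented D) (hM : IsMissingMatching D) {x x' y y' z z' : V}
    (hy : (missingGraph D).Adj y y') (hz : (missingGraph D).Adj z z')
    (h : Loses D x x' y' y) (h' : Loses D x x' z' z) : y = z := by
  by_contra hne
  have hne' : z' ≠ y' := by
    rintro rfl
    exact hne (hM.eq hy.symm hz.symm)
  exact hD _ _ (h.adj_of_adj hM hy h'.1 hne') (h'.swap.adj_of_adj hM hz.symm h.2.2.1 hne)

/-- If `x ≠ y`, an arc joins `x` and `y'`. Inherited by `z` or `z'`, it makes a digon with `y' → z`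
or `x → z'`. -/
theorem Loses.left_unique (hD : IsOriented D) (hM : IsMissingMatching D) {x x' y y' z z' : V}
    (hx : (missingGraph D).Adj x x') (hy : (missingGraph D).Adj y y')
    (hz : (missingGraph D).Adj z z')
    (h : Loses D x x' z' z) (h' : Loses D y y' z' z) : x = y := by
  by_contra hne
  have hne' : x ≠ y' := by
    rintro rfl
    exact h.not_adj h'.2.2.1
  have hmiss : ¬ (missingGraph D).Adj x y' := by
    intro h1
    have := hM.eq h1 hx
    subst this
    exact hne (hM.eq hx.symm hy.symm)
  rcases adj_or_adj hne' hmiss with h1 | h1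
  · refine hD _ _ h'.2.2.1 (h.adj_of_adj hM hz h1 ?_)
    rintro rfl
    exact hz.2.2 h'.2.2.1
  · refine hD _ _ h.1 (h'.swap.adj_of_adj hM hz.symm h1 ?_)
    rintro rfl
    exact hz.2.1 h.1

theorem exists_loses_of_adj {e f : MissingEdge D} (h : (dependencyDigraph D).Adj e f) {a b : V}
    (he : e.1 = s(a, b)) : ∃ c d, f.1 = s(c, d) ∧ Loses D a b c d := by
  obtain ⟨x, x', y, y', h1, h2, h3⟩ := h
  rw [he, Sym2.eq_iff] at h1
  rcases h1 with ⟨rfl, rfl⟩ | ⟨rfl, rfl⟩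
  · exact ⟨y, y', h2, h3⟩
  · exact ⟨y', y, by rw [h2, Sym2.eq_swap], h3.swap⟩

theorem exists_loses_of_adj' {e f : MissingEdge D} (h : (dependencyDigraph D).Adj e f) {c d : V}
    (hf : f.1 = s(c, d)) : ∃ a b, e.1 = s(a, b) ∧ Loses D a b c d := by
  obtain ⟨x, x', y, y', h1, h2, h3⟩ := h
  rw [hf, Sym2.eq_iff] at h2
  rcases h2 with ⟨rfl, rfl⟩ | ⟨rfl, rfl⟩
  · exact ⟨x, x', h1, h3⟩
  · exact ⟨x', x, by rw [h1, Sym2.eq_swap], h3.swap⟩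

theorem MissingEdge.adj {e : MissingEdge D} {a b : V} (h : e.1 = s(a, b)) :
    (missingGraph D).Adj a b := by
  have := e.2
  rwa [h] at this

theorem dependencyDigraph_right_unique (hD : IsOriented D) (hM : IsMissingMatching D)
    {e f g : MissingEdge D} (h : (dependencyDigraph D).Adj e f)
    (h' : (dependencyDigraph D).Adj e g) : f = g := by
  obtain ⟨e, he⟩ := e
  induction e using Sym2.ind with
  | _ a b =>
  obtain ⟨c, d, hf, h1⟩ := exists_loses_of_adj h rfl
  obtain ⟨c', d', hg, h2⟩ := exists_loses_of_adj h' rfl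
  have e1 := h1.right_unique hD hM (MissingEdge.adj hf).symm (MissingEdge.adj hg).symm h2
  subst e1
  have e2 := hM.eq (MissingEdge.adj hf).symm (MissingEdge.adj hg).symm
  subst e2
  exact Subtype.ext (hf.trans hg.symm)

theorem dependencyDigraph_left_unique (hD : IsOriented D) (hM : IsMissingMatching D)
    {e f g : MissingEdge D} (h : (dependencyDigraph D).Adj e g)
    (h' : (dependencyDigraph D).Adj f g) : e = f := by
  obtain ⟨g, hg⟩ := g
  induction g using Sym2.ind with
  | _ c d =>
  obtain ⟨a, b, he, h1⟩ := exists_loses_of_adj' h rfl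
  obtain ⟨a', b', hf, h2⟩ := exists_loses_of_adj' h' rfl
  have e1 := h1.left_unique hD hM (MissingEdge.adj he) (MissingEdge.adj hf)
    (hg : (missingGraph D).Adj c d).symm h2
  subst e1
  have e2 := hM.eq (MissingEdge.adj he) (MissingEdge.adj hf)
  subst e2
  exact Subtype.ext (he.trans hf.symm)

/-! ### Components of Δ and the losing permutation. -/

/-- A walk against which every vertex has a unique predecessor does not repeat vertices if its
first vertex has no predecessor. -/
theorem eq_of_walk_eq {E : Type*} {R : E → E → Prop} (hR : ∀ e f g, R e g → R f g → e = f)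
    {e : ℕ → E} {n : ℕ} (h0 : ∀ f, ¬ R f (e 0)) (hs : ∀ i < n, R (e i) (e (i + 1))) :
    ∀ i j, i ≤ n → j ≤ n → e i = e j → i = j := by
  intro i
  induction i with
  | zero =>
    rintro (_ | j) - hj h
    · rfl
    · exact absurd (h ▸ hs j (by omega)) (h0 _)
  | succ i ih =>
    rintro (_ | j) hi hj h
    · exact absurd (h ▸ hs i (by omega)) (h0 _)
    · have h1 := hs i (by omega)
      rw [h] at h1
      rw [ih j (by omega) (by omega) (hR _ _ _ h1 (hs j (by omega)))]

/-- The walk of successive losses from `ab` cannot repeat, hence stops; uniqueness on both sides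
makes it a whole component. -/
theorem exists_isPathComponent [Finite V] (hD : IsOriented D) (hM : IsMissingMatching D) {a b : V}
    (hab : (missingGraph D).Adj a b)
    (h : ∀ e : MissingEdge D, ¬ (dependencyDigraph D).Adj e ⟨s(a, b), hab⟩) :
    ∃ C, IsPathComponent D C := by
  classical
  let P := {x : V × V // (missingGraph D).Adj x.1 x.2}
  let R : P → P → Prop := fun x y => Loses D x.1.1 x.1.2 y.1.1 y.1.2
  -- The walk runs on ordered pairs to keep the endpoints named consistently; the next pair is
  -- arbitrary where no loss is available.
  have hstep : ∀ x : P, ∃ y : P, (∃ z, R x z) → R x y := by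
    intro x
    by_cases hx : ∃ z, R x z
    · exact ⟨hx.choose, fun _ => hx.choose_spec⟩
    · exact ⟨x, fun h => absurd h hx⟩
  choose next hnext using hstep
  let w : ℕ → P := fun n => next^[n] ⟨(a, b), hab⟩
  have hw : ∀ n, (∃ z, R (w n) z) → R (w n) (w (n + 1)) := by
    intro n hn
    simp only [w, Function.iterate_succ_apply'] at hn ⊢
    exact hnext _ hn
  let e : ℕ → MissingEdge D := fun n => ⟨s((w n).1.1, (w n).1.2), (w n).2⟩
  have he : ∀ n, R (w n) (w (n + 1)) → (dependencyDigraph D).Adj (e n) (e (n + 1)) :=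
    fun n hn => ⟨_, _, _, _, rfl, rfl, hn⟩
  have he' : ∀ n f, (dependencyDigraph D).Adj (e n) f → ∃ z, R (w n) z := by
    intro n f hf
    obtain ⟨c, d, hf', hl⟩ := exists_loses_of_adj hf rfl
    exact ⟨⟨(c, d), MissingEdge.adj hf'⟩, hl⟩
  have hinj : ∀ n, (∀ i < n, ∃ z, R (w i) z) → ∀ i j, i ≤ n → j ≤ n → e i = e j → i = j :=
    fun n hn => eq_of_walk_eq (R := (dependencyDigraph D).Adj)
      (fun _ _ _ => dependencyDigraph_left_unique hD hM) h
      fun i hi => he i (hw i (hn i hi))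
  have hex : ∃ n, ¬ ∃ z, R (w n) z := by
    by_contra hc
    push Not at hc
    have : Function.Injective e := fun i j hij =>
      hinj (max i j) (fun i _ => hc i) i j (le_max_left _ _) (le_max_right _ _) hij
    exact not_injective_infinite_finite e this
  obtain ⟨n, hn, hmin⟩ : ∃ n, (¬ ∃ z, R (w n) z) ∧ ∀ i < n, ∃ z, R (w i) z :=
    ⟨Nat.find hex, Nat.find_spec hex, fun i hi => not_not.1 (Nat.find_min hex hi)⟩
  have hs : ∀ i < n, (dependencyDigraph D).Adj (e i) (e (i + 1)) :=
    fun i hi => he i (hw i (hmin i hi))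
  have hinj := hinj n hmin
  have hadj : ∀ i ≤ n, ∀ f, (dependencyDigraph D).Adj (e i) f → i < n ∧ f = e (i + 1) := by
    intro i hi f hf
    have hlt : i < n := by
      rcases hi.lt_or_eq with h1 | rfl
      · exact h1
      · exact absurd (he' _ _ hf) hn
    exact ⟨hlt, dependencyDigraph_right_unique hD hM hf (hs i hlt)⟩
  refine ⟨(dependencyDigraph D).toSimpleGraphInclusive.connectedComponentMk (e 0), n,
    fun i => (w i).1.1, fun i => (w i).1.2, ?_⟩
  refine ⟨fun i => (w i).2, fun i j hij => ?_, fun f => ⟨fun hf => ?_, ?_⟩, fun i j => ⟨?_, ?_⟩, ?_⟩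
  · exact Fin.ext (hinj i j (by omega) (by omega) (Subtype.ext hij))
  · rw [SimpleGraph.ConnectedComponent.mem_supp_iff, SimpleGraph.ConnectedComponent.eq] at hf
    have hclosed : ∀ f g, (dependencyDigraph D).toSimpleGraphInclusive.Walk f g →
        (∃ i ≤ n, g = e i) → ∃ i ≤ n, f = e i := by
      intro f g p hg
      induction p with
      | nil => exact hg
      | @cons u v _ huv _ ih =>
        obtain ⟨i, hi, rfl⟩ := ih hg
        obtain ⟨-, h1 | h1⟩ := huv
        · rcases i with _ | i
          · exact absurd h1 (h _)
          · exact ⟨i, by omega, dependencyDigraph_left_unique hD hM h1 (hs i (by omega))⟩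
        · obtain ⟨h2, h3⟩ := hadj i hi _ h1
          exact ⟨i + 1, h2, h3⟩
    obtain ⟨i, hi, rfl⟩ := hclosed f (e 0) hf.some ⟨0, Nat.zero_le _, rfl⟩
    exact ⟨⟨i, by omega⟩, rfl⟩
  · rintro ⟨⟨i, hi⟩, hfi⟩
    have : f = e i := Subtype.ext hfi
    subst this
    rw [SimpleGraph.ConnectedComponent.mem_supp_iff, SimpleGraph.ConnectedComponent.eq]
    clear hfi
    induction i with
    | zero => exact SimpleGraph.Reachable.refl _
    | succ i ih =>
      refine SimpleGraph.Reachable.trans (SimpleGraph.Adj.reachable ⟨?_, Or.inr (hs i (by omega))⟩)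
        (ih (by omega))
      intro heq
      have := hinj _ _ (by omega) (by omega) heq
      omega
  · intro hij
    obtain ⟨h1, h2⟩ := hadj i (by omega) (e j) hij
    exact (hinj _ _ (by omega) (by omega) h2).symm
  · intro hij
    have := hs i (by omega)
    rw [hij] at this
    exact this
  · intro i j hij
    have := hw i (hmin i (by omega))
    rw [hij] at this
    exact ⟨this.1, this.2.2.1⟩

theorem IsAddedArcSet.not_isPathComponent (hF : IsAddedArcSet D ∅) (C : DependencyComponent D) :
    ¬ IsPathComponent D C := by
  intro hC
  obtain ⟨A, hA, hU⟩ := hF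
  have hsub : A C ⊆ ∅ := by
    rw [hU]
    exact Set.subset_iUnion₂ (s := fun C (_ : IsPathComponent D C) => A C) C hC
  obtain ⟨n, a, b, -, ⟨-, h⟩ | ⟨-, h⟩⟩ := hA C hC
  · exact hsub (h ▸ Set.mem_range_self 0)
  · exact hsub (h ▸ Set.mem_range_self 0)

/-- `m` exchanges the endpoints of every missing edge, and the permutation `τ` witnesses that all
components of the dependency digraph are directed cycles. -/
structure IsLosingPerm (D : Digraph V) (m : V → V) (τ : Equiv.Perm V) : Prop where
  mate_eq : ∀ x y, (missingGraph D).Adj x y → m x = y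
  mate_mate : ∀ x, m (m x) = x
  mate_comm : ∀ x, τ (m x) = m (τ x)
  mate_whole : ∀ x, ¬ (missingGraph D).Adj x (m x) → m x = x
  whole : ∀ x, ¬ (missingGraph D).Adj x (m x) → τ x = x
  missing : ∀ x, (missingGraph D).Adj x (m x) → (missingGraph D).Adj (τ x) (m (τ x))
  loses : ∀ x, (missingGraph D).Adj x (m x) → Loses D x (m x) (m (τ x)) (τ x)

theorem exists_isLosingPerm [Finite V] (hD : IsOriented D) (hM : IsMissingMatching D)
    (hC : ∀ C, ¬ IsPathComponent D C) : ∃ m τ, IsLosingPerm D m τ := by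
  classical
  have hmate : ∀ x, ∃ y, (∀ z, (missingGraph D).Adj x z → y = z) ∧
      (¬ (missingGraph D).Adj x y → y = x) := by
    intro x
    by_cases hx : ∃ y, (missingGraph D).Adj x y
    · obtain ⟨y, hy⟩ := hx
      exact ⟨y, fun z hz => hM.eq hy hz, fun h => absurd hy h⟩
    · exact ⟨x, fun z hz => absurd ⟨z, hz⟩ hx, fun _ => rfl⟩
  choose m hm hm' using hmate
  have hmm : ∀ x, m (m x) = x := by
    intro x
    by_cases hx : (missingGraph D).Adj x (m x)
    · exact hm _ _ hx.symm
    · rw [hm' x hx, hm' x hx]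
  have hpred : ∀ x, ∃ y, ((missingGraph D).Adj x (m x) →
      (missingGraph D).Adj y (m y) ∧ Loses D y (m y) (m x) x) ∧
      (¬ (missingGraph D).Adj x (m x) → y = x) := by
    intro x
    by_cases hx : (missingGraph D).Adj x (m x)
    · have : ∃ e : MissingEdge D, (dependencyDigraph D).Adj e ⟨s(m x, x), hx.symm⟩ := by
        by_contra hc
        push Not at hc
        obtain ⟨C, hC'⟩ := exists_isPathComponent hD hM hx.symm hc
        exact hC C hC'
      obtain ⟨e, he⟩ := this
      obtain ⟨y, y', he, hl⟩ := exists_loses_of_adj' he rfl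
      have hy := MissingEdge.adj he
      obtain rfl := hm _ _ hy
      exact ⟨y, fun _ => ⟨hy, hl⟩, fun h => absurd hx h⟩
    · exact ⟨x, fun h => absurd h hx, fun _ => rfl⟩
  choose π h1 h2 using hpred
  have hinj : Function.Injective π := by
    intro x y hxy
    by_cases hx : (missingGraph D).Adj x (m x) <;> by_cases hy : (missingGraph D).Adj y (m y)
    · have hx' := (h1 x hx).2
      have hy' := (h1 y hy).2
      rw [hxy] at hx'
      exact hx'.right_unique hD hM hx hy hy'
    · have := (h1 x hx).1
      rw [hxy, h2 y hy] at this
      exact absurd this hy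
    · have := (h1 y hy).1
      rw [← hxy, h2 x hx] at this
      exact absurd this hx
    · rwa [h2 x hx, h2 y hy] at hxy
  -- `π` goes from an edge to the edge losing to it, so its inverse follows the losses.
  let τ : Equiv.Perm V := (Equiv.ofBijective π (Finite.injective_iff_bijective.1 hinj)).symm
  have hτ : ∀ x, π (τ x) = x := fun x =>
    (Equiv.ofBijective π (Finite.injective_iff_bijective.1 hinj)).apply_symm_apply x
  have hmiss : ∀ x, (missingGraph D).Adj x (m x) → (missingGraph D).Adj (τ x) (m (τ x)) := by
    intro x hx
    by_contra hc
    have := h2 _ hc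
    rw [hτ] at this
    rw [← this] at hc
    exact hc hx
  have hwhole : ∀ x, ¬ (missingGraph D).Adj x (m x) → τ x = x := by
    intro x hx
    by_cases hc : (missingGraph D).Adj (τ x) (m (τ x))
    · have := (h1 _ hc).1
      rw [hτ] at this
      exact absurd this hx
    · rw [← h2 _ hc, hτ]
  have hloses : ∀ x, (missingGraph D).Adj x (m x) → Loses D x (m x) (m (τ x)) (τ x) := by
    intro x hx
    have := (h1 _ (hmiss x hx)).2
    rwa [hτ] at this
  refine ⟨m, τ, hm, hmm, fun x => ?_, hm', hwhole, hmiss, hloses⟩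
  by_cases hx : (missingGraph D).Adj x (m x)
  · have hx' : (missingGraph D).Adj (m x) (m (m x)) := by rw [hmm]; exact hx.symm
    have e1 := hloses _ hx'
    rw [hmm] at e1
    exact e1.right_unique hD hM (hmiss _ hx') (hmiss x hx).symm (hloses x hx).swap
  · rw [hm' x hx, hwhole x hx, hm' x hx]

/-! ### The cycles of `τ` as modules, and the SNP inside them. -/

namespace IsLosingPerm

variable {m : V → V} {τ : Equiv.Perm V}

theorem adj_apply (hD : IsOriented D) (hM : IsMissingMatching D) (h : IsLosingPerm D m τ) {x : V}
    (hx : (missingGraph D).Adj x (m x)) : D.Adj (τ x) x :=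
  (h.loses x hx).adj_head hD hM hx (h.missing x hx)

theorem adj_apply_of_adj (hM : IsMissingMatching D) (h : IsLosingPerm D m τ) {x w : V}
    (hw : D.Adj x w) (hne : w ≠ m (τ x)) : D.Adj (τ x) w := by
  by_cases hx : (missingGraph D).Adj x (m x)
  · exact (h.loses x hx).adj_of_adj hM (h.missing x hx) hw hne
  · rwa [h.whole x hx]

theorem mate_inj (h : IsLosingPerm D m τ) {x y : V} (hxy : m x = m y) : x = y := by
  rw [← h.mate_mate x, hxy, h.mate_mate]

theorem mate_pow_comm (h : IsLosingPerm D m τ) (n : ℕ) (x : V) : (τ ^ n) (m x) = m ((τ ^ n) x) := by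
  induction n with
  | zero => rfl
  | succ n ih => rw [pow_succ', Equiv.Perm.mul_apply, ih, h.mate_comm, Equiv.Perm.mul_apply]

/-- The arc `τ x → x` is inherited along the orbit; inheritance can fail only at the step that
arrives at `m x`. -/
theorem adj_pow (hD : IsOriented D) (hM : IsMissingMatching D) (h : IsLosingPerm D m τ) {x : V}
    (hx : (missingGraph D).Adj x (m x)) {k : ℕ} (hk : ∀ i < k, (τ ^ i) x ≠ m x) :
    ∀ i, i + 1 < k → D.Adj ((τ ^ (i + 1)) x) x := by
  intro i
  induction i with
  | zero => intro _; simpa using h.adj_apply hD hM hx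
  | succ i ih =>
    intro hi
    rw [pow_succ', Equiv.Perm.mul_apply]
    refine h.adj_apply_of_adj hM (ih (by omega)) fun heq => hk (i + 2) hi ?_
    rw [pow_succ', Equiv.Perm.mul_apply]
    exact h.mate_inj (heq.symm.trans (h.mate_mate x).symm)

/-- An orbit avoiding `m x` would carry the arc all the way round to a loop at `x`. -/
theorem exists_pow_eq_mate [Finite V] (hD : IsOriented D) (hM : IsMissingMatching D)
    (h : IsLosingPerm D m τ) {x : V} (hx : (missingGraph D).Adj x (m x)) :
    ∃ k, (τ ^ k) x = m x ∧ ∀ i, 0 < i → i < k → D.Adj ((τ ^ i) x) x := by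
  classical
  have hex : ∃ k, (τ ^ k) x = m x := by
    by_contra hc
    push Not at hc
    have h1 := h.adj_pow hD hM hx (k := orderOf τ + 1) (fun i _ => hc i) (orderOf τ - 1)
      (by have := orderOf_pos τ; omega)
    rw [Nat.sub_add_cancel (orderOf_pos τ), pow_orderOf_eq_one] at h1
    exact hD _ _ h1 h1
  refine ⟨Nat.find hex, Nat.find_spec hex, fun i hi hlt => ?_⟩
  obtain ⟨i, rfl⟩ := Nat.exists_eq_succ_of_ne_zero hi.ne'
  exact h.adj_pow hD hM hx (fun i hi => Nat.find_min hex hi) i hlt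

theorem sameCycle_mate [Finite V] (hD : IsOriented D) (hM : IsMissingMatching D)
    (h : IsLosingPerm D m τ) (x : V) : τ.SameCycle x (m x) := by
  by_cases hx : (missingGraph D).Adj x (m x)
  · obtain ⟨k, hk, -⟩ := h.exists_pow_eq_mate hD hM hx
    exact ⟨k, by simpa using hk⟩
  · rw [h.mate_whole x hx]

/-- From `m x` on, the orbit is the image under `m` of the orbit from `x`, so exponents can be
lowered by `k`. -/
theorem adj_or_mate_adj [Finite V] (hD : IsOriented D) (hM : IsMissingMatching D)
    (h : IsLosingPerm D m τ) {x w : V} (hxw : τ.SameCycle x w) :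
    w = x ∨ w = m x ∨ D.Adj w x ∨ D.Adj (m w) x := by
  obtain ⟨j, rfl⟩ := hxw.exists_nat_pow_eq
  by_cases hx : (missingGraph D).Adj x (m x)
  · obtain ⟨k, hk, hlt⟩ := h.exists_pow_eq_mate hD hM hx
    have hk0 : k ≠ 0 := by
      rintro rfl
      exact hx.1 hk
    induction j using Nat.strong_induction_on with
    | _ j ih =>
    rcases lt_or_ge j k with hjk | hjk
    · rcases Nat.eq_zero_or_pos j with rfl | hj
      · exact Or.inl rfl
      · exact Or.inr (Or.inr (Or.inl (hlt j hj hjk)))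
    · have e : (τ ^ j) x = m ((τ ^ (j - k)) x) := by
        rw [← h.mate_pow_comm, ← hk, ← Equiv.Perm.mul_apply, ← pow_add, Nat.sub_add_cancel hjk]
      rw [e, h.mate_mate]
      rcases ih (j - k) (by omega) ⟨(j - k : ℕ), by simp⟩ with h1 | h1 | h1 | h1
      · exact Or.inr (Or.inl (by rw [h1]))
      · exact Or.inl (by rw [h1, h.mate_mate])
      · exact Or.inr (Or.inr (Or.inr h1))
      · exact Or.inr (Or.inr (Or.inl h1))
  · exact Or.inl (Function.IsFixedPt.perm_pow (h.whole x hx) j)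

/-- The cycles of `τ` are modules of `D`. -/
theorem adj_of_sameCycle [Finite V] (hD : IsOriented D) (hM : IsMissingMatching D)
    (h : IsLosingPerm D m τ) {x y w : V} (hxw : D.Adj x w) (hn : ¬ τ.SameCycle x w)
    (hxy : τ.SameCycle x y) : D.Adj y w := by
  obtain ⟨j, rfl⟩ := hxy.exists_nat_pow_eq
  clear hxy
  induction j with
  | zero => exact hxw
  | succ j ih =>
    rw [pow_succ', Equiv.Perm.mul_apply]
    -- The only out-neighbor that is not inherited lies in the cycle, and `w` does not.
    refine h.adj_apply_of_adj hM ih ?_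
    rintro rfl
    refine hn (Equiv.Perm.SameCycle.trans ?_ (h.sameCycle_mate hD hM _))
    exact ⟨j + 1, by rw [← Equiv.Perm.mul_apply, ← pow_succ']; norm_cast⟩

theorem adj_or_adj_of_not_sameCycle [Finite V] (hD : IsOriented D) (hM : IsMissingMatching D)
    (h : IsLosingPerm D m τ) {x y : V} (hn : ¬ τ.SameCycle x y) : D.Adj x y ∨ D.Adj y x := by
  refine adj_or_adj (fun hxy => hn (hxy ▸ Equiv.Perm.SameCycle.refl _ _)) fun hxy => hn ?_
  rw [← h.mate_eq x y hxy]
  exact h.sameCycle_mate hD hM x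

/-- The injection is `w ↦ τ (m w)`. For `z → w` in the cycle, `w → τ (m w)` and `m w → z`; an arc
from `z` to `τ (m w) = m (τ w)` would let `m w` reach it in two steps, against the loss. -/
theorem ncard_inter_le [Finite V] (hD : IsOriented D) (hM : IsMissingMatching D)
    (h : IsLosingPerm D m τ) (z : V) :
    (outNbhd D z ∩ {w | τ.SameCycle z w}).ncard ≤
      (secondOutNbhd D z ∩ {w | τ.SameCycle z w}).ncard := by
  refine Set.ncard_le_ncard_of_injOn (fun w => τ (m w)) ?_
    (fun a _ b _ hab => h.mate_inj (τ.injective hab)) (Set.toFinite _)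
  rintro w ⟨hzw : D.Adj z w, hc : τ.SameCycle z w⟩
  have hw : (missingGraph D).Adj w (m w) := by
    by_contra hw
    have := (hc.symm.exists_nat_pow_eq).choose_spec
    rw [Function.IsFixedPt.perm_pow (h.whole w hw)] at this
    exact hD _ _ hzw (this ▸ hzw)
  have hl := h.loses w hw
  have hb : D.Adj (m w) z := by
    rcases h.adj_or_mate_adj hD hM hc with h1 | h1 | h1 | h1
    · subst h1; exact absurd hzw (hD _ _ hzw)
    · subst h1
      rw [h.mate_mate] at hw
      exact absurd hzw hw.2.2
    · exact absurd h1 (hD _ _ hzw)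
    · exact h1
  have hwτ : D.Adj w (τ (m w)) := by rw [h.mate_comm]; exact hl.1
  refine ⟨⟨?_, ?_, w, hzw, hwτ⟩, ?_⟩
  · intro heq
    rw [heq] at hwτ
    exact hD _ _ hzw hwτ
  · intro hz
    rw [h.mate_comm] at hz
    refine hl.2.2.2 (Or.inr ⟨?_, hl.swap.not_adj, z, hb, hz⟩)
    intro heq
    rw [heq] at hz
    exact hD _ _ hz hb
  · exact (hc.trans (h.sameCycle_mate hD hM w)).trans ⟨1, by simp⟩

theorem hasSNP_of_ncard_diff_le [Finite V] (hD : IsOriented D) (hM : IsMissingMatching D)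
    (h : IsLosingPerm D m τ) {z : V} (hz : (outNbhd D z \ {w | τ.SameCycle z w}).ncard ≤
      (secondOutNbhd D z \ {w | τ.SameCycle z w}).ncard) : HasSNP D z := by
  rw [HasSNP, ← Set.ncard_inter_add_ncard_sdiff_eq_ncard (outNbhd D z) {w | τ.SameCycle z w},
    ← Set.ncard_inter_add_ncard_sdiff_eq_ncard (secondOutNbhd D z) {w | τ.SameCycle z w}]
  exact add_le_add (h.ncard_inter_le hD hM z) hz

end IsLosingPerm

end Losing

end SecondNeighborhood

/-! ### Passing to a tournament and back. -/

theorem theorem4 {V : Type*} [Finite V] [Nonempty V] (D : Digraph V)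
    (hD : SecondNeighborhood.IsOriented D)
    (hM : SecondNeighborhood.IsMissingMatching D)
    (F : Set (V × V)) (hF : SecondNeighborhood.IsAddedArcSet D F) (hF0 : F = ∅)
    (hsink : ∀ v, ¬ SecondNeighborhood.IsSink D v) :
    ∃ u v, u ≠ v ∧ SecondNeighborhood.HasSNP D u ∧ SecondNeighborhood.HasSNP D v := by
  open SecondNeighborhood in
  subst hF0
  obtain ⟨m, τ, h⟩ := exists_isLosingPerm hD hM hF.not_isPathComponent
  obtain ⟨f, hf⟩ := exists_injective_nat V
  -- The injection `f` is an arbitrary linear order, making every cycle transitive; arcs between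
  -- cycles are those of D.
  let T : Digraph V :=
    { Adj := fun x y => (τ.SameCycle x y ∧ f x < f y) ∨ (¬ τ.SameCycle x y ∧ D.Adj x y) }
  have hT : IsOriented T := by
    rintro x y (⟨h1, h2⟩ | ⟨h1, h2⟩) (⟨h3, h4⟩ | ⟨h3, h4⟩)
    · omega
    · exact h3 h1.symm
    · exact h1 h3.symm
    · exact hD _ _ h2 h4
  have ht : ∀ x y, x ≠ y → T.Adj x y ∨ T.Adj y x := by
    intro x y hxy
    by_cases hc : τ.SameCycle x y
    · rcases lt_or_gt_of_ne (hf.ne hxy) with h1 | h1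
      · exact Or.inl (Or.inl ⟨hc, h1⟩)
      · exact Or.inr (Or.inl ⟨hc.symm, h1⟩)
    · rcases h.adj_or_adj_of_not_sameCycle hD hM hc with h1 | h1
      · exact Or.inl (Or.inr ⟨hc, h1⟩)
      · exact Or.inr (Or.inr ⟨fun h => hc h.symm, h1⟩)
  have hin : ∀ x y w, D.Adj w x → ¬ τ.SameCycle w x → τ.SameCycle x y → D.Adj w y := by
    intro x y w hwx hn hxy
    refine (h.adj_or_adj_of_not_sameCycle hD hM fun hc => hn (hc.trans hxy.symm)).resolve_right
      fun hyw => hD _ _ hwx (h.adj_of_sameCycle hD hM hyw ?_ hxy.symm)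
    exact fun hc => hn (hxy.trans hc).symm
  have hSNP : ∀ v, HasSNP T v → HasSNP D v := by
    intro v hv
    refine h.hasSNP_of_ncard_diff_le hD hM (le_trans (Set.ncard_le_ncard ?_ (Set.toFinite _))
      (hv.trans (Set.ncard_le_ncard ?_ (Set.toFinite _))))
    · rintro w ⟨hw, hc⟩
      exact Or.inr ⟨hc, hw⟩
    · rintro w ⟨hwv, hnw, u, hvu, huw⟩
      -- By transitivity inside modules, no second out-neighbor in `T` lies in the module of `v`.
      have hc : ¬ τ.SameCycle v w := by
        intro hc
        rcases hvu with ⟨h1, h2⟩ | ⟨h1, h2⟩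
        · rcases huw with ⟨h3, h4⟩ | ⟨h3, h4⟩
          · exact hnw (Or.inl ⟨hc, h2.trans h4⟩)
          · exact h3 (h1.symm.trans hc)
        · rcases huw with ⟨h3, h4⟩ | ⟨h3, h4⟩
          · exact h1 (hc.trans h3.symm)
          · exact hD _ _ h4 (h.adj_of_sameCycle hD hM h2 h1 hc)
      have hnw' : ¬ D.Adj v w := fun h1 => hnw (Or.inr ⟨hc, h1⟩)
      -- If either arc of the path stayed inside a module, the module property would already give an
      -- arc from `v` to `w`; so both arcs are in D.
      refine ⟨⟨hwv, hnw', u, ?_, ?_⟩, hc⟩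
      · rcases hvu with ⟨h1, h2⟩ | ⟨h1, h2⟩
        · rcases huw with ⟨h3, h4⟩ | ⟨h3, h4⟩
          · exact absurd (h1.trans h3) hc
          · exact absurd (h.adj_of_sameCycle hD hM h4 h3 h1.symm) hnw'
        · exact h2
      · rcases huw with ⟨h3, h4⟩ | ⟨h3, h4⟩
        · rcases hvu with ⟨h1, h2⟩ | ⟨h1, h2⟩
          · exact absurd (h1.trans h3) hc
          · exact absurd (hin u w v h2 h1 h3) hnw'
        · exact h4
  by_cases hTs : ∃ v, IsSink T v
  · obtain ⟨v, hv⟩ := hTs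
    have hv' : ∀ w, ¬ T.Adj v w := fun w hw => by
      have : w ∈ outNbhd T v := hw
      rw [hv] at this
      exact this
    -- An arc leaving the module would also start at `v`, which is a sink of `T`.
    have hout : ∀ z w, τ.SameCycle v z → D.Adj z w → τ.SameCycle z w := by
      intro z w hz hzw
      by_contra hc
      exact hv' w (Or.inr ⟨fun h1 => hc (hz.symm.trans h1),
        h.adj_of_sameCycle hD hM hzw hc hz.symm⟩)
    have hz : ∀ z, τ.SameCycle v z → HasSNP D z := by
      intro z hz
      refine h.hasSNP_of_ncard_diff_le hD hM ?_
      have : outNbhd D z \ {w | τ.SameCycle z w} = ∅ :=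
        Set.sdiff_eq_empty.2 fun w hw => hout z w hz hw
      simp [this]
    obtain ⟨w, hw⟩ := Set.nonempty_iff_ne_empty.2 (hsink v)
    have hvw : D.Adj v w := hw
    refine ⟨v, w, ?_, hz v (Equiv.Perm.SameCycle.refl _ _),
      hz w (hout v w (Equiv.Perm.SameCycle.refl _ _) hvw)⟩
    rintro rfl
    exact hD _ _ hvw hvw
  · push Not at hTs
    obtain ⟨u, v, huv, hu, hv⟩ := exists_two_hasSNP_of_tournament hT ht hTs
    exact ⟨u, v, huv, hSNP u hu, hSNP v hv⟩
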